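/- Let $\mathbb N=\{1,2,\dots\}$. For a Borel probability measure $\rho$ on $\mathbb T=\mathbb R/\mathbb Z$ put $\phi_\rho(n)=\int_{\mathbb T}e^{2\pi i n x}\,d\rho(x)$, and suppose $\phi_\rho(n)=\phi_\rho(-n)$ for all $n\in\mathbb Z$. The Gaussian system associated with $\rho$ is $(\mathbb R^{\mathbb Z},\mathcal A,\gamma,T)$, where $\mathcal A=\mathrm{Borel}(\mathbb R^{\mathbb Z})$, $T(\omega)(n)=\omega(n+1)$, and $\gamma$ is the $T$-invariant probability measure on $\mathcal A$ for which the coordinate projections $X_n(\omega)=\omega(n)$, $n\in\mathbb Z$, form a centered Gaussian process with covariance $\int X_mX_n\,d\gamma=\phi_\rho(m-n)$ for all $m,n\in\mathbb Z$. **Theorem A$'$.** Let $p\in\mathbb Z[x]$ with $p(0)=0$ and $\deg p>1$. There exist a Borel probability measure $\rho$ on $\mathbb T$ with $\phi_\rho(n)=\phi_\rho(-n)$ for all $n$, with associated Gaussian system $(\mathbb R^{\mathbb Z},\mathcal A,\gamma,T)$, and a family of finite sequences $((n_{t,s})_{s=1}^{t})_{t\in\mathbb N}$ in $\mathbb N$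 such that the set $A=\{X_0>0\}\in\mathcal A$ satisfies $\gamma(A)=\frac12$ and the following holds. For every $\varepsilon>0$ there is $t_\varepsilon\in\mathbb N$ such that for every $t\ge t_\varepsilon$, every $\ell\ge 1$, all $s_1<\cdots<s_\ell$ in $\{1,\dots,t\}$ and all $\xi_1,\dots,\xi_\ell\in\{-1,1\}$, $$\gamma\Bigl(A\cap T^{-p\left(\sum_{j=1}^{\ell}\xi_jn_{t,s_j}\right)}A\Bigr)<\frac16+\varepsilon .$$ -/

import Mathlib

open MeasureTheory ProbabilityTheory

/-- The shift `T` on `ℝ^ℤ`, `(T ω)(n) = ω(n + 1)`, as a bijection, so that the iterates `T ^ k`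
make sense for every integer `k`. -/
def shift : Equiv.Perm (ℤ → ℝ) where
  toFun ω := fun n => ω (n + 1)
  invFun ω := fun n => ω (n - 1)
  left_inv ω := by
    funext n
    simp
  right_inv ω := by
    funext n
    simp

/-- The function `φ_ρ(n) = ∫ e^{2πinx} dρ(x)` of a Borel measure `ρ` on the circle `𝕋 = ℝ/ℤ`. -/
noncomputable def spectralCoeff (ρ : Measure UnitAddCircle) (n : ℤ) : ℂ :=
  ∫ x, fourier n x ∂ρ

/-- `(ℝ^ℤ, Borel, γ, shift)` is the Gaussian system associated with the Borel probability
measure `ρ` on the circle, where `φ_ρ(n) = φ_ρ(-n)` for all `n`: the measure `γ` is a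
shift-invariant probability measure for which the coordinate projections form a centered
Gaussian process with covariance `φ_ρ(m - n)`. -/
structure IsGaussianSystem (ρ : Measure UnitAddCircle) (γ : Measure (ℤ → ℝ)) : Prop where
  isProbabilityMeasure_spectral : IsProbabilityMeasure ρ
  symmetric : ∀ n : ℤ, spectralCoeff ρ n = spectralCoeff ρ (-n)
  isProbabilityMeasure : IsProbabilityMeasure γ
  measurePreserving : MeasurePreserving shift γ γ
  isGaussianProcess : IsGaussianProcess (fun (n : ℤ) (ω : ℤ → ℝ) => ω n) γ
  centered : ∀ n : ℤ, ∫ ω, ω n ∂γ = 0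
  covariance : ∀ m n : ℤ, ((∫ ω, ω m * ω n ∂γ : ℝ) : ℂ) = spectralCoeff ρ (m - n)

/-!
For a Gaussian system with spectral measure `ρ` the coordinates `X_0` and `X_k` are standard
Gaussian variables with correlation `φ_ρ(k) = cos θ`, so `X_0 > 0` and `X_k > 0` together cut out a
sector of opening `π - θ` of the Gaussian plane, of measure `(π - θ) / (2π)`
(`IsGaussianSystem.measureReal_pos_inter_le`). This equals `1/6` for `θ = 2π/3`, so it suffices to
find a `ρ` for which `φ_ρ(p(m)) ≤ -1/2 + o(1)` at all nonempty signed sums `m` of the `n_{t,s}`. A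
Gaussian system with a prescribed spectral measure exists because the Gram-Schmidt process, applied
to the modes `e^{2πinx}` in `L²(ρ)`, writes the desired process as finite combinations of
independent Gaussian variables (`exists_isGaussianSystem`).

The value `-1/2` comes from the norm form `a² + ab + b²` of `𝔽₄` over `𝔽₂`, which is `1` at three of
the four points of `𝔽₂²`. If `L₁, L₂` are independent uniform linear forms on `𝔽₂ᵗ` and
`Q = L₁² + L₁ L₂ + L₂²`, then for each `v ≠ 0` the pair `(L₁ v, L₂ v)` is uniform, whence
`𝔼 (-1)^{Q(v)} = -1/2` (`FormPair.sum_sign_quad`). Signed sums `∑ v_s n_s` have `v ∈ {0, ±1}ᵗ`, and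
such a `v` is nonzero modulo `2` as soon as it is nonzero.

To realise `Q(v)/2` as a phase `p(∑ v_s n_s) x` modulo `1`, let `n_s = B ^ (d + 1) ^ s` with
`d = deg p` and `B` large and divisible. The monomials of `p(∑ v_s n_s)` then carry distinct powers
of `B`, and a point `y` that is the inverse of twice the term `v_r^{d-1} v_s` gives this monomial
phase `v_r^{d-1} v_s / 2 ≡ v_r v_s / 2`, the higher monomials integral phases and the lower ones
small phases (`exists_isolating_frequencies`). Sums of such `y` give a point `X_t(Q)` of the circle
for each form `Q` (`exists_stage`).

Finally `ρ` is the symmetrised law of `∑_t X_t(Q_t)` with independent `Q_t`. The stages are chosen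
inductively: the `n_{t,s}` are multiples of the orders of all earlier points, which therefore do not
contribute at the times of stage `t`, and later points are so small that they hardly contribute
(`exists_stage_sequence`, `exists_measure_of_stages`).
-/

/-! ### Gaussian processes with a given covariance -/

/-- The characteristic function of the finite-dimensional marginals of a centered Gaussian process,
in terms of its covariance. -/
theorem IsGaussianProcess.charFunDual_map_restrict {T Ω : Type*} [DecidableEq T]
    {mΩ : MeasurableSpace Ω} {P : Measure Ω} {X : T → Ω → ℝ}
    (hX : IsGaussianProcess X P) (hX0 : ∀ t, ∫ ω, X t ω ∂P = 0) (I : Finset T)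
    (L : StrongDual ℝ (I → ℝ)) :
    charFunDual (P.map (fun ω => I.restrict (X · ω))) L
      = Complex.exp (-((∑ i, ∑ j, L (Pi.single i 1) * L (Pi.single j 1)
          * ∫ ω, X i ω * X j ω ∂P : ℝ) : ℂ) / 2) := by
  have hdual : ∀ x : I → ℝ, L x = ∑ i, L (Pi.single i 1) * x i := by
    intro x
    conv_lhs => rw [pi_eq_sum_univ' x]
    rw [map_sum]
    refine Finset.sum_congr rfl fun i _ => ?_
    rw [map_smul, smul_eq_mul, mul_comm]
  have := hX.isProbabilityMeasure
  have hint : ∀ i, Integrable (X i) P := fun i => (hX.hasGaussianLaw_eval i).integrable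
  have hmem : ∀ i, MemLp (X i) 2 P := fun i => (hX.hasGaussianLaw_eval i).memLp_two
  have hL : (fun ω => L (I.restrict (X · ω))) = fun ω => ∑ i : I, L (Pi.single i 1) * X i ω := by
    funext ω
    rw [hdual]
    rfl
  have hmean : ∫ ω, L (I.restrict (X · ω)) ∂P = 0 := by
    rw [hL, integral_finsetSum _ fun (i : I) _ => (hint i).const_mul _]
    simp [integral_const_mul, hX0]
  have hsq : ∫ ω, (L (I.restrict (X · ω))) ^ 2 ∂P
      = ∑ i, ∑ j, L (Pi.single i 1) * L (Pi.single j 1) * ∫ ω, X i ω * X j ω ∂P := by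
    have h2 : ∀ ω, (L (I.restrict (X · ω))) ^ 2 = ∑ i : I, ∑ j : I,
        L (Pi.single i 1) * L (Pi.single j 1) * (X i ω * X j ω) := by
      intro ω
      rw [congrFun hL ω, sq, Finset.sum_mul_sum]
      refine Finset.sum_congr rfl fun i _ => Finset.sum_congr rfl fun j _ => by ring
    simp_rw [h2]
    have hm : ∀ i j : I, Integrable (fun ω => L (Pi.single i 1) * L (Pi.single j 1)
        * (X i ω * X j ω)) P := fun i j => ((hmem i).integrable_mul (hmem j)).const_mul _
    rw [integral_finsetSum _ fun i _ => integrable_finsetSum _ fun j _ => hm i j]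
    refine Finset.sum_congr rfl fun i _ => ?_
    rw [integral_finsetSum _ fun j _ => hm i j]
    refine Finset.sum_congr rfl fun j _ => ?_
    rw [integral_const_mul]
  rw [(hX.hasGaussianLaw I).charFunDual_map_eq_fun L,
    variance_of_integral_eq_zero ((hX.hasGaussianLaw I).map_fun L).aemeasurable hmean, hmean, hsq]
  congr 1
  push_cast
  ring

/-- The law of a centered Gaussian process is determined by its covariance. -/
theorem IsGaussianProcess.map_restrict_eq {T Ω Ω' : Type*} {mΩ : MeasurableSpace Ω}
    {mΩ' : MeasurableSpace Ω'} {P : Measure Ω} {Q : Measure Ω'} {X : T → Ω → ℝ} {Y : T → Ω' → ℝ}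
    (hX : IsGaussianProcess X P) (hY : IsGaussianProcess Y Q)
    (hX0 : ∀ t, ∫ ω, X t ω ∂P = 0) (hY0 : ∀ t, ∫ ω, Y t ω ∂Q = 0)
    (hXY : ∀ s t, ∫ ω, X s ω * X t ω ∂P = ∫ ω, Y s ω * Y t ω ∂Q) (I : Finset T) :
    P.map (fun ω => I.restrict (X · ω)) = Q.map (fun ω => I.restrict (Y · ω)) := by
  classical
  have hP := hX.isProbabilityMeasure
  have hQ := hY.isProbabilityMeasure
  have h1 := (hX.hasGaussianLaw I).isGaussian_map
  have h2 := (hY.hasGaussianLaw I).isGaussian_map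
  apply Measure.ext_of_charFunDual
  funext L
  rw [charFunDual_map_restrict hX hX0, charFunDual_map_restrict hY hY0]
  simp_rw [hXY]

/-- A sequence of vectors in a real inner product space is the covariance structure of a centered
Gaussian process: the Gram-Schmidt process writes each vector as a finite combination of
orthogonal vectors, which are replaced by independent Gaussian variables. -/
theorem exists_isGaussianProcess_inner {H : Type*} [NormedAddCommGroup H] [InnerProductSpace ℝ H]
    (f : ℕ → H) : ∃ (μ : Measure (ℕ → ℝ)) (X : ℕ → (ℕ → ℝ) → ℝ), IsGaussianProcess X μ ∧
      (∀ n, Measurable (X n)) ∧ (∀ n, ∫ ω, X n ω ∂μ = 0) ∧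
      ∀ m n, ∫ ω, X m ω * X n ω ∂μ = inner ℝ (f m) (f n) := by
  set e := InnerProductSpace.gramSchmidt ℝ f with he
  have hc : ∀ n, ∃ c : ℕ → ℝ, f n = ∑ k ∈ Finset.range (n + 1), c k • e k := by
    intro n
    have h := InnerProductSpace.mem_span_gramSchmidt ℝ f (le_refl n)
    have hset : Set.Iic n = ((Finset.range (n + 1) : Finset ℕ) : Set ℕ) := by
      ext i
      simp
    rw [hset, Submodule.mem_span_image_finset_iff_exists_fun] at h
    obtain ⟨c, hc⟩ := h
    refine ⟨fun k => if h : k ∈ Finset.range (n + 1) then c ⟨k, h⟩ else 0, ?_⟩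
    have h2 := Finset.sum_coe_sort (Finset.range (n + 1))
      fun k => (if h : k ∈ Finset.range (n + 1) then c ⟨k, h⟩ else 0) • e k
    rw [← hc, ← h2]
    exact Finset.sum_congr rfl fun k _ => by rw [dif_pos k.2]
  choose c hc using hc
  let μ : Measure (ℕ → ℝ) := Measure.infinitePi fun k => gaussianReal 0 (‖e k‖₊ ^ 2)
  have hlaw : ∀ k, μ.map (fun ω => ω k) = gaussianReal 0 (‖e k‖₊ ^ 2) := fun k =>
    Measure.infinitePi_map_eval _ k
  have hg : ∀ k, HasGaussianLaw (fun ω : ℕ → ℝ => ω k) μ := fun k =>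
    ⟨by rw [hlaw]; infer_instance⟩
  have hind : iIndepFun (fun k (ω : ℕ → ℝ) => ω k) μ :=
    iIndepFun_infinitePi (X := fun _ x => x) fun _ => measurable_id
  have hproc : IsGaussianProcess (fun k (ω : ℕ → ℝ) => ω k) μ :=
    ⟨fun I => (hind.precomp Subtype.val_injective).hasGaussianLaw fun i => hg i⟩
  have hmean : ∀ k, ∫ ω, ω k ∂μ = 0 := by
    intro k
    have := integral_map (μ := μ) (φ := fun ω : ℕ → ℝ => ω k) (f := fun x => x)
      (measurable_pi_apply k).aemeasurable (by fun_prop)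
    rw [← this, hlaw, integral_id_gaussianReal]
  have hcov : ∀ j k, ∫ ω, ω j * ω k ∂μ = inner ℝ (e j) (e k) := by
    intro j k
    by_cases hjk : j = k
    · subst hjk
      have h1 := variance_of_integral_eq_zero (μ := μ) (X := fun ω : ℕ → ℝ => ω j)
        (measurable_pi_apply j).aemeasurable (hmean j)
      have h2 := variance_map (μ := μ) (X := fun x : ℝ => x) (Y := fun ω : ℕ → ℝ => ω j)
        (by fun_prop) (measurable_pi_apply j).aemeasurable
      rw [hlaw, variance_fun_id_gaussianReal] at h2
      simp_rw [← pow_two]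
      rw [← h1, real_inner_self_eq_norm_sq]
      change _ = variance (fun ω : ℕ → ℝ => ω j) μ at h2
      rw [← h2]
      simp
    · have := (hind.indepFun hjk).integral_mul_eq_mul_integral
        (measurable_pi_apply j).aestronglyMeasurable (measurable_pi_apply k).aestronglyMeasurable
      simp only [Pi.mul_apply] at this
      rw [this, hmean, zero_mul, InnerProductSpace.gramSchmidt_orthogonal ℝ f hjk]
  refine ⟨μ, fun n ω => ∑ k ∈ Finset.range (n + 1), c n k * ω k, ?_, ?_, ?_, ?_⟩
  · refine hproc.of_isGaussianProcess fun n => ⟨Finset.range (n + 1),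
      ∑ k : Finset.range (n + 1), c n k • ContinuousLinearMap.proj k, fun ω => ?_⟩
    rw [sum_apply, ← Finset.sum_coe_sort]
    rfl
  · intro n
    fun_prop
  · intro n
    rw [integral_finsetSum _ fun k _ => (hg k).integrable.const_mul _]
    simp [integral_const_mul, hmean]
  · intro m n
    have hm : ∀ j k : ℕ, Integrable (fun ω : ℕ → ℝ => c m j * c n k * (ω j * ω k)) μ :=
      fun j k => ((hg j).memLp_two.integrable_mul (hg k).memLp_two).const_mul _
    rw [hc m, hc n, sum_inner]
    simp_rw [inner_sum, real_inner_smul_left, real_inner_smul_right, ← hcov, Finset.sum_mul_sum]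
    have h2 : ∀ (ω : ℕ → ℝ) (j k : ℕ), c m j * ω j * (c n k * ω k) = c m j * c n k * (ω j * ω k) :=
      fun ω j k => by ring
    simp_rw [h2]
    rw [integral_finsetSum _ fun i _ => integrable_finsetSum _ fun j _ => hm i j]
    refine Finset.sum_congr rfl fun i _ => ?_
    rw [integral_finsetSum _ fun j _ => hm i j]
    refine Finset.sum_congr rfl fun j _ => ?_
    rw [integral_const_mul, mul_assoc]

/-! ### Existence of the Gaussian system -/

/-- Symmetry of the spectral coefficients means that they are real. -/
theorem spectralCoeff_im_eq_zero {ρ : Measure UnitAddCircle}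
    (hρ : ∀ n : ℤ, spectralCoeff ρ n = spectralCoeff ρ (-n)) (n : ℤ) :
    (spectralCoeff ρ n).im = 0 := by
  rw [← Complex.conj_eq_iff_im, spectralCoeff, ← integral_conj]
  simp_rw [← fourier_neg]
  exact (hρ n).symm

/-- The modes `x ↦ e^{2πinx}` in `L²(ρ)`, viewed as a real Hilbert space, have the Gram matrix
`Re φ_ρ(m - n)`. -/
theorem inner_toLp_fourier (ρ : Measure UnitAddCircle) [IsFiniteMeasure ρ] (m n : ℤ) :
    inner ℝ (ContinuousMap.toLp 2 ρ ℂ (fourier n) : Lp ℂ 2 ρ)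
      (ContinuousMap.toLp 2 ρ ℂ (fourier m)) = (spectralCoeff ρ (m - n)).re := by
  rw [L2.inner_def, spectralCoeff]
  have hint : Integrable (fun x => fourier (m - n) x) ρ :=
    (fourier (m - n)).continuous.integrable_of_hasCompactSupport
      (HasCompactSupport.of_compactSpace _)
  have hre := integral_re hint
  simp only [RCLike.re_to_complex] at hre
  rw [← hre]
  refine integral_congr_ae ?_
  filter_upwards [ContinuousMap.coeFn_toLp (p := 2) (𝕜 := ℂ) ρ (fourier n),
    ContinuousMap.coeFn_toLp (p := 2) (𝕜 := ℂ) ρ (fourier m)] with x hn hm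
  rw [hn, hm, Complex.inner, ← fourier_neg, ← fourier_add]
  congr 2

/-- Every Borel probability measure on the circle with symmetric coefficients has an associated
Gaussian system. -/
theorem exists_isGaussianSystem (ρ : Measure UnitAddCircle) [IsProbabilityMeasure ρ]
    (hρ : ∀ n : ℤ, spectralCoeff ρ n = spectralCoeff ρ (-n)) :
    ∃ γ : Measure (ℤ → ℝ), IsGaussianSystem ρ γ := by
  obtain ⟨μ, X, hX, hXm, hX0, hXX⟩ := exists_isGaussianProcess_inner
    fun k => (ContinuousMap.toLp 2 ρ ℂ (fourier (Equiv.intEquivNat.symm k)) : Lp ℂ 2 ρ)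
  let Y : (ℕ → ℝ) → ℤ → ℝ := fun ω n => X (Equiv.intEquivNat n) ω
  have hY : Measurable Y := measurable_pi_lambda _ fun n => hXm _
  have hμ := hX.isProbabilityMeasure
  have hproc : IsGaussianProcess (fun (n : ℤ) (ω : ℤ → ℝ) => ω n) (μ.map Y) := by
    refine ⟨fun I => ⟨?_⟩⟩
    rw [Measure.map_map (by fun_prop) hY]
    exact ((hX.comp_right Equiv.intEquivNat).hasGaussianLaw I).isGaussian_map
  have hmean : ∀ n : ℤ, ∫ ω, ω n ∂(μ.map Y) = 0 := by
    intro n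
    rw [integral_map hY.aemeasurable (measurable_pi_apply n).aestronglyMeasurable]
    exact hX0 _
  have hcov : ∀ m n : ℤ, ∫ ω, ω m * ω n ∂(μ.map Y) = (spectralCoeff ρ (m - n)).re := by
    intro m n
    rw [integral_map hY.aemeasurable (by fun_prop), ← inner_toLp_fourier, real_inner_comm]
    simp only [Y, hXX, Equiv.symm_apply_apply]
  have hshift : Measurable shift := measurable_pi_lambda _ fun n => measurable_pi_apply (n + 1)
  have := Measure.isProbabilityMeasure_map (μ := μ) hY.aemeasurable
  -- the shifted process has the same covariance, hence the same law
  refine ⟨μ.map Y, ⟨inferInstance, hρ, inferInstance, ⟨hshift, ?_⟩, hproc, hmean, ?_⟩⟩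
  · refine IsProjectiveLimit.unique
      (P := fun I => (μ.map Y).map (fun ω => I.restrict fun n => ω n)) (fun I => ?_) fun I => rfl
    rw [Measure.map_map (by fun_prop) hshift]
    refine IsGaussianProcess.map_restrict_eq (hproc.comp_right fun n => n + 1) hproc
      (fun n => hmean _) hmean (fun m n => ?_) I
    rw [hcov]
    refine (hcov _ _).trans ?_
    rw [add_sub_add_right_eq_sub]
  · intro m n
    rw [hcov]
    exact Complex.ext (Complex.ofReal_re _)
      ((Complex.ofReal_im _).trans (spectralCoeff_im_eq_zero hρ _).symm)

/-! ### The orthant probability of two Gaussian variables -/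

/-- A function of the radius alone integrates over an angular sector to a multiple of its
opening. -/
theorem setLIntegral_radial_sector (g : ℝ → ENNReal) (hg : Measurable g) (α β : ℝ) :
    ∫⁻ p in Set.Ioi (0 : ℝ) ×ˢ Set.Ioo α β, g p.1
      = (∫⁻ r in Set.Ioi (0 : ℝ), g r) * ENNReal.ofReal (β - α) := by
  have h := lintegral_prod_mul (μ := (volume : Measure ℝ).restrict (Set.Ioi 0))
    (ν := (volume : Measure ℝ).restrict (Set.Ioo α β)) (f := g) (g := fun _ => 1)
    hg.aemeasurable aemeasurable_const
  rw [Measure.volume_eq_prod, ← Measure.prod_restrict]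
  simpa using h

/-- The standard Gaussian measure of the plane in polar coordinates. -/
theorem gaussianReal_prod_apply_polar (S : Set (ℝ × ℝ)) (hS : MeasurableSet S) :
    ((gaussianReal 0 1).prod (gaussianReal 0 1)) S =
      ∫⁻ p in polarCoord.target, S.indicator 1 (polarCoord.symm p)
        * (ENNReal.ofReal (p.1 * ((2 * Real.pi)⁻¹ * Real.exp (-(p.1 ^ 2) / 2)))) := by
  have hdens : ∀ z : ℝ × ℝ, gaussianPDF 0 1 z.1 * gaussianPDF 0 1 z.2
      = ENNReal.ofReal ((2 * Real.pi)⁻¹ * Real.exp (-(z.1 ^ 2 + z.2 ^ 2) / 2)) := by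
    intro z
    rw [gaussianPDF, gaussianPDF, ← ENNReal.ofReal_mul (gaussianPDFReal_nonneg _ _ _)]
    congr 1
    simp only [gaussianPDFReal, NNReal.coe_one, mul_one, sub_zero]
    rw [mul_mul_mul_comm, ← Real.exp_add, ← mul_inv, Real.mul_self_sqrt (by positivity)]
    congr 2
    ring
  rw [gaussianReal_of_var_ne_zero 0 one_ne_zero,
    prod_withDensity (measurable_gaussianPDF 0 1) (measurable_gaussianPDF 0 1),
    ← Measure.volume_eq_prod, withDensity_apply _ hS, ← lintegral_indicator hS,
    ← lintegral_comp_polarCoord_symm]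
  refine setLIntegral_congr_fun polarCoord.open_target.measurableSet fun p hp => ?_
  have hr : 0 < p.1 := hp.1
  by_cases hpS : polarCoord.symm p ∈ S
  · simp only [Set.indicator_of_mem hpS, hdens, Pi.one_apply, one_mul, smul_eq_mul]
    rw [← ENNReal.ofReal_mul hr.le]
    congr 4
    simp only [polarCoord_symm_apply]
    linear_combination (-p.1 ^ 2 / 2) * Real.sin_sq_add_cos_sq p.2
  · rw [Set.indicator_of_notMem hpS, Set.indicator_of_notMem hpS, zero_mul, smul_zero]

/-- Two standard Gaussian variables at angle `θ` are simultaneously positive with probability at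
most the relative opening of the sector between `θ - π/2` and `π/2`. -/
theorem gaussianReal_prod_sector_le {θ : ℝ} (hπ : θ ≤ Real.pi) :
    ((gaussianReal 0 1).prod (gaussianReal 0 1))
      {z : ℝ × ℝ | 0 < z.1 ∧ 0 < Real.cos θ * z.1 + Real.sin θ * z.2}
      ≤ ENNReal.ofReal ((Real.pi - θ) / (2 * Real.pi)) := by
  set g : ℝ → ENNReal := fun r =>
    ENNReal.ofReal (r * ((2 * Real.pi)⁻¹ * Real.exp (-(r ^ 2) / 2))) with hg
  have hgm : Measurable g := by fun_prop
  have hpos := Real.pi_pos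
  -- the radial integral is read off from the total mass
  have hK : (∫⁻ r in Set.Ioi (0 : ℝ), g r) * ENNReal.ofReal (2 * Real.pi) = 1 := by
    have h := gaussianReal_prod_apply_polar Set.univ MeasurableSet.univ
    simp only [Set.indicator_univ, Pi.one_apply, one_mul, measure_univ] at h
    have h2 := setLIntegral_radial_sector g hgm (-Real.pi) Real.pi
    rw [show Real.pi - -Real.pi = 2 * Real.pi by ring] at h2
    rw [← h2, h]
    rfl
  have hmeas : MeasurableSet
      {z : ℝ × ℝ | 0 < z.1 ∧ 0 < Real.cos θ * z.1 + Real.sin θ * z.2} :=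
    (measurableSet_lt measurable_const measurable_fst).inter
      (measurableSet_lt measurable_const
        (by fun_prop : Measurable fun z : ℝ × ℝ => Real.cos θ * z.1 + Real.sin θ * z.2))
  rw [gaussianReal_prod_apply_polar _ hmeas]
  calc _ ≤ ∫⁻ p in polarCoord.target,
        (Set.Ioi (0 : ℝ) ×ˢ Set.Ioo (θ - Real.pi / 2) (Real.pi / 2)).indicator
          (fun p => g p.1) p := by
        refine setLIntegral_mono' polarCoord.open_target.measurableSet fun p hp => ?_
        have hr : 0 < p.1 := hp.1
        have h1 : -Real.pi < p.2 := hp.2.1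
        have h2 : p.2 < Real.pi := hp.2.2
        -- both `cos p.2` and `cos (p.2 - θ)` are positive on the region, which bounds the angle
        by_cases hpS : polarCoord.symm p ∈
            {z : ℝ × ℝ | 0 < z.1 ∧ 0 < Real.cos θ * z.1 + Real.sin θ * z.2}
        · have hcos : 0 < Real.cos p.2 := pos_of_mul_pos_right hpS.1 hr.le
          have hcos' : 0 < Real.cos (p.2 - θ) := by
            have := hpS.2
            simp only [polarCoord_symm_apply] at this
            rw [show Real.cos θ * (p.1 * Real.cos p.2) + Real.sin θ * (p.1 * Real.sin p.2)
              = p.1 * Real.cos (p.2 - θ) by rw [Real.cos_sub]; ring] at this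
            exact pos_of_mul_pos_right this hr.le
          have h3 : p.2 < Real.pi / 2 := by
            by_contra! h
            exact absurd hcos (not_lt.2 (Real.cos_nonpos_of_pi_div_two_le_of_le h (by linarith)))
          have h4 : θ - Real.pi / 2 < p.2 := by
            by_contra! h
            refine absurd hcos' (not_lt.2 ?_)
            rw [← Real.cos_neg]
            have h5 : -(Real.pi / 2) < p.2 := by
              by_contra! h
              refine absurd hcos (not_lt.2 ?_)
              rw [← Real.cos_neg]
              exact Real.cos_nonpos_of_pi_div_two_le_of_le (by linarith) (by linarith)
            exact Real.cos_nonpos_of_pi_div_two_le_of_le (by linarith) (by linarith)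
          have hmem : p ∈ Set.Ioi (0 : ℝ) ×ˢ Set.Ioo (θ - Real.pi / 2) (Real.pi / 2) :=
            ⟨hr, h4, h3⟩
          rw [Set.indicator_of_mem hpS, Set.indicator_of_mem hmem]
          simp [hg]
        · rw [Set.indicator_of_notMem hpS, zero_mul]
          exact zero_le
    _ ≤ ∫⁻ p, (Set.Ioi (0 : ℝ) ×ˢ Set.Ioo (θ - Real.pi / 2) (Real.pi / 2)).indicator
          (fun p => g p.1) p := setLIntegral_le_lintegral _ _
    _ = (∫⁻ r in Set.Ioi (0 : ℝ), g r) * ENNReal.ofReal (Real.pi - θ) := by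
        rw [lintegral_indicator (measurableSet_Ioi.prod measurableSet_Ioo),
          setLIntegral_radial_sector g hgm]
        congr 2
        ring
    _ = ENNReal.ofReal ((Real.pi - θ) / (2 * Real.pi)) := by
        rw [ENNReal.ofReal_div_of_pos (by positivity), ENNReal.div_eq_inv_mul]
        congr 1
        exact ENNReal.eq_inv_of_mul_eq_one_left hK

theorem abs_spectralCoeff_re_le_one (ρ : Measure UnitAddCircle) [IsProbabilityMeasure ρ] (n : ℤ) :
    |(spectralCoeff ρ n).re| ≤ 1 := by
  refine (Complex.abs_re_le_norm _).trans ((norm_integral_le_integral_norm _).trans ?_)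
  simp only [fourier_apply, Circle.norm_coe]
  simp

theorem shift_zpow_apply (k : ℤ) (ω : ℤ → ℝ) (n : ℤ) : (shift ^ k) ω n = ω (n + k) := by
  induction k generalizing ω n with
  | zero => simp
  | succ i ih =>
    rw [zpow_add_one, Equiv.Perm.mul_apply, ih]
    change ω (n + i + 1) = _
    rw [add_assoc]
  | pred i ih =>
    rw [zpow_sub_one, Equiv.Perm.mul_apply, ih]
    change ω (n + -i - 1) = _
    rw [add_sub_assoc]

/-- The correlation of `X_0` and `X_k` is `cos θ`, where `θ = arccos φ_ρ(k)`. -/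
theorem IsGaussianSystem.measureReal_pos_inter_le {ρ : Measure UnitAddCircle}
    {γ : Measure (ℤ → ℝ)} (hsys : IsGaussianSystem ρ γ) (k : ℤ) :
    γ.real ({ω | 0 < ω 0} ∩ (shift ^ k) ⁻¹' {ω | 0 < ω 0})
      ≤ (Real.pi - Real.arccos (spectralCoeff ρ k).re) / (2 * Real.pi) := by
  have := hsys.isProbabilityMeasure_spectral
  have := hsys.isProbabilityMeasure
  set r := (spectralCoeff ρ k).re with hr
  set θ := Real.arccos r with hθ
  have hr1 := abs_le.1 (abs_spectralCoeff_re_le_one ρ k)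
  have hcos : Real.cos θ = r := Real.cos_arccos hr1.1 hr1.2
  have hcov : ∀ m n : ℤ, ∫ ω, ω m * ω n ∂γ = (spectralCoeff ρ (m - n)).re := fun m n => by
    rw [← hsys.covariance, Complex.ofReal_re]
  have h0 : (spectralCoeff ρ 0).re = 1 := by simp [spectralCoeff]
  -- `(X_0, X_k)` has the law of `(z₁, cos θ z₁ + sin θ z₂)` for a standard Gaussian `z`; this
  -- includes the degenerate case `|r| = 1`
  let Q : Measure (ℝ × ℝ) := (gaussianReal 0 1).prod (gaussianReal 0 1)
  let Y : Fin 2 → ℝ × ℝ → ℝ :=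
    ![fun z => z.1, fun z => Real.cos θ * z.1 + Real.sin θ * z.2]
  have hfst : HasGaussianLaw (fun z : ℝ × ℝ => z.1) Q := ⟨by
    rw [show Q.map (fun z : ℝ × ℝ => z.1) = gaussianReal 0 1 from Measure.fst_prod]
    infer_instance⟩
  have hsnd : HasGaussianLaw (fun z : ℝ × ℝ => z.2) Q := ⟨by
    rw [show Q.map (fun z : ℝ × ℝ => z.2) = gaussianReal 0 1 from Measure.snd_prod]
    infer_instance⟩
  have hind : IndepFun (fun z : ℝ × ℝ => z.1) (fun z : ℝ × ℝ => z.2) Q :=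
    indepFun_prod measurable_id measurable_id
  have hYg : IsGaussianProcess Y Q := by
    refine ⟨fun I => ?_⟩
    let l : Fin 2 → ((ℝ × ℝ) →L[ℝ] ℝ) := ![ContinuousLinearMap.fst ℝ ℝ ℝ,
      Real.cos θ • ContinuousLinearMap.fst ℝ ℝ ℝ + Real.sin θ • ContinuousLinearMap.snd ℝ ℝ ℝ]
    have hl : ∀ i z, l i z = Y i z := by
      intro i z
      fin_cases i <;> simp [l, Y]
    have := (hind.hasGaussianLaw hfst hsnd).map_fun (ContinuousLinearMap.pi fun i : I => l i)
    have hfun : (fun z => I.restrict (Y · z))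
        = fun z : ℝ × ℝ => (ContinuousLinearMap.pi fun i : I => l i) (z.1, z.2) := by
      funext z i
      exact (hl i z).symm
    rw [hfun]
    exact this
  have m1 : ∫ x : ℝ, x ∂(gaussianReal 0 1) = 0 := integral_id_gaussianReal
  have m2 : ∫ x : ℝ, x * x ∂(gaussianReal 0 1) = 1 := by
    have h1 := variance_of_integral_eq_zero (μ := gaussianReal 0 1) (X := fun x : ℝ => x)
      (by fun_prop) m1
    rw [variance_fun_id_gaussianReal] at h1
    simp_rw [← pow_two]
    simpa using h1.symm
  have i1 : ∫ z : ℝ × ℝ, z.1 ∂Q = 0 := by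
    have := integral_prod_mul (μ := gaussianReal 0 1) (ν := gaussianReal 0 1)
      (fun x : ℝ => x) (fun _ : ℝ => (1 : ℝ))
    simpa [m1] using this
  have i2 : ∫ z : ℝ × ℝ, z.2 ∂Q = 0 := by
    have := integral_prod_mul (μ := gaussianReal 0 1) (ν := gaussianReal 0 1)
      (fun _ : ℝ => (1 : ℝ)) (fun x : ℝ => x)
    simpa [m1] using this
  have i11 : ∫ z : ℝ × ℝ, z.1 * z.1 ∂Q = 1 := by
    have := integral_prod_mul (μ := gaussianReal 0 1) (ν := gaussianReal 0 1)
      (fun x : ℝ => x * x) (fun _ : ℝ => (1 : ℝ))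
    simpa [m2] using this
  have i22 : ∫ z : ℝ × ℝ, z.2 * z.2 ∂Q = 1 := by
    have := integral_prod_mul (μ := gaussianReal 0 1) (ν := gaussianReal 0 1)
      (fun _ : ℝ => (1 : ℝ)) (fun x : ℝ => x * x)
    simpa [m2] using this
  have i12 : ∫ z : ℝ × ℝ, z.1 * z.2 ∂Q = 0 := by
    have := integral_prod_mul (μ := gaussianReal 0 1) (ν := gaussianReal 0 1)
      (fun x : ℝ => x) (fun x : ℝ => x)
    simpa [m1] using this
  have q11 : Integrable (fun z : ℝ × ℝ => z.1 * z.1) Q :=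
    hfst.memLp_two.integrable_mul hfst.memLp_two
  have q12 : Integrable (fun z : ℝ × ℝ => z.1 * z.2) Q :=
    hfst.memLp_two.integrable_mul hsnd.memLp_two
  have q22 : Integrable (fun z : ℝ × ℝ => z.2 * z.2) Q :=
    hsnd.memLp_two.integrable_mul hsnd.memLp_two
  have c01 : ∫ z : ℝ × ℝ, z.1 * (Real.cos θ * z.1 + Real.sin θ * z.2) ∂Q = Real.cos θ := by
    have e : ∀ z : ℝ × ℝ, z.1 * (Real.cos θ * z.1 + Real.sin θ * z.2)
        = Real.cos θ * (z.1 * z.1) + Real.sin θ * (z.1 * z.2) := fun z => by ring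
    simp_rw [e]
    rw [integral_add (q11.const_mul _) (q12.const_mul _), integral_const_mul, integral_const_mul,
      i11, i12]
    ring
  have c11 : ∫ z : ℝ × ℝ, (Real.cos θ * z.1 + Real.sin θ * z.2)
      * (Real.cos θ * z.1 + Real.sin θ * z.2) ∂Q = 1 := by
    have e : ∀ z : ℝ × ℝ, (Real.cos θ * z.1 + Real.sin θ * z.2)
        * (Real.cos θ * z.1 + Real.sin θ * z.2)
        = Real.cos θ ^ 2 * (z.1 * z.1) + Real.sin θ ^ 2 * (z.2 * z.2)
          + 2 * Real.cos θ * Real.sin θ * (z.1 * z.2) := fun z => by ring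
    simp_rw [e]
    have q := (q11.const_mul (Real.cos θ ^ 2)).add (q22.const_mul (Real.sin θ ^ 2))
    simp only [Pi.add_def] at q
    rw [integral_add q (q12.const_mul _),
      integral_add (q11.const_mul _) (q22.const_mul _), integral_const_mul, integral_const_mul,
      integral_const_mul, i11, i22, i12]
    linear_combination Real.sin_sq_add_cos_sq θ
  have hlaw := IsGaussianProcess.map_restrict_eq
    (hsys.isGaussianProcess.comp_right (![0, k] : Fin 2 → ℤ)) hYg (fun i => hsys.centered _)
    (fun i => by
      fin_cases i
      · exact i1
      · change ∫ z : ℝ × ℝ, (Real.cos θ * z.1 + Real.sin θ * z.2) ∂Q = 0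
        rw [integral_add (hfst.integrable.const_mul _) (hsnd.integrable.const_mul _),
          integral_const_mul, integral_const_mul, i1, i2]
        ring)
    (fun i j => by
      refine (hcov _ _).trans ?_
      fin_cases i <;> fin_cases j
      · simp only [Y, Fin.zero_eta, Fin.isValue, Matrix.cons_val_zero, sub_self, h0]
        exact i11.symm
      · change (spectralCoeff ρ (0 - k)).re = _
        rw [zero_sub, ← hsys.symmetric, ← hr, ← hcos]
        exact c01.symm
      · change (spectralCoeff ρ (k - 0)).re = _
        rw [sub_zero, ← hr, ← hcos, ← c01]
        exact integral_congr_ae (ae_of_all _ fun z => mul_comm _ _)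
      · change (spectralCoeff ρ (k - k)).re = _
        rw [sub_self, h0]
        exact c11.symm) Finset.univ
  let S : Set (↥(Finset.univ : Finset (Fin 2)) → ℝ) :=
    {x | 0 < x ⟨0, Finset.mem_univ _⟩ ∧ 0 < x ⟨1, Finset.mem_univ _⟩}
  have hS : MeasurableSet S :=
    (measurableSet_lt measurable_const (measurable_pi_apply _)).inter
      (measurableSet_lt measurable_const (measurable_pi_apply _))
  have happ := congrArg (fun m => m S) hlaw
  rw [Measure.map_apply_of_aemeasurable ((hsys.isGaussianProcess.comp_right
    (![0, k] : Fin 2 → ℤ)).hasGaussianLaw _).aemeasurable hS,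
    Measure.map_apply_of_aemeasurable (hYg.hasGaussianLaw _).aemeasurable hS] at happ
  have hset : {ω : ℤ → ℝ | 0 < ω 0} ∩ (shift ^ k) ⁻¹' {ω | 0 < ω 0}
      = {ω | 0 < ω 0 ∧ 0 < ω k} := by
    ext ω
    simp [shift_zpow_apply]
  have hle := gaussianReal_prod_sector_le (Real.arccos_le_pi r)
  rw [hset]
  refine ENNReal.toReal_le_of_le_ofReal
    (div_nonneg (sub_nonneg.2 (Real.arccos_le_pi r)) (by positivity)) (le_trans (le_of_eq ?_) hle)
  exact happ

theorem IsGaussianSystem.measure_pos {ρ : Measure UnitAddCircle} {γ : Measure (ℤ → ℝ)}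
    (hsys : IsGaussianSystem ρ γ) : γ {ω | 0 < ω 0} = 1 / 2 := by
  have := hsys.isProbabilityMeasure_spectral
  have := hsys.isProbabilityMeasure
  have hg := hsys.isGaussianProcess.hasGaussianLaw_eval 0
  have hvar : variance (fun ω : ℤ → ℝ => ω 0) γ = 1 := by
    rw [variance_of_integral_eq_zero hg.aemeasurable (hsys.centered 0)]
    have h1 := hsys.covariance 0 0
    have h0 : spectralCoeff ρ 0 = 1 := by simp [spectralCoeff]
    rw [sub_zero, h0] at h1
    simp_rw [pow_two]
    exact_mod_cast h1
  have hmap : γ.map (fun ω : ℤ → ℝ => ω 0) = gaussianReal 0 1 := by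
    rw [hg.map_eq_gaussianReal, hvar, hsys.centered]
    simp
  have hhalf : gaussianReal 0 1 (Set.Ioi 0) = 1 / 2 := by
    have hneg : gaussianReal 0 1 (Set.Iio 0) = gaussianReal 0 1 (Set.Ioi 0) := by
      have h2 : (gaussianReal 0 1).map (fun x => -x) = gaussianReal 0 1 := by
        rw [gaussianReal_map_neg, neg_zero]
      conv_lhs => rw [← h2]
      rw [Measure.map_apply measurable_neg measurableSet_Iio]
      simp
    have hna : NullSingletonClass (gaussianReal 0 1) := nullSingletonClass_gaussianReal one_ne_zero
    have hsum : gaussianReal 0 1 (Set.Iic 0) + gaussianReal 0 1 (Set.Ioi 0) = 1 := by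
      rw [← Set.compl_Iic, measure_add_measure_compl measurableSet_Iic, measure_univ]
    rw [← Iio_ae_eq_Iic.measure_eq, hneg, ← mul_two] at hsum
    rw [one_div]
    exact ENNReal.eq_inv_of_mul_eq_one_left hsum
  rw [← hhalf, ← hmap, Measure.map_apply (measurable_pi_apply 0) measurableSet_Ioi]
  rfl

/-! ### Points of the circle that isolate a monomial -/

/-- Integers vanish in `ℝ/ℤ`. -/
theorem UnitAddCircle.coe_intCast (z : ℤ) : ((z : ℝ) : UnitAddCircle) = 0 :=
  (AddCircle.coe_eq_zero_iff 1).2 ⟨z, by simp⟩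

theorem UnitAddCircle.norm_coe_le_abs (x : ℝ) : ‖(x : UnitAddCircle)‖ ≤ |x| := by
  rw [UnitAddCircle.norm_eq]
  simpa using round_le x 0

/-- Base-`b` expansions are unique: a multiset with fewer than `b` elements is determined by the
sum of the `b ^ s` over its elements. -/
theorem Multiset.eq_of_sum_map_pow_eq {t b : ℕ} {k k' : Multiset (Fin t)}
    (hk : k.card < b) (hk' : k'.card < b)
    (h : (k.map fun s : Fin t => b ^ (s : ℕ)).sum
      = (k'.map fun s : Fin t => b ^ (s : ℕ)).sum) : k = k' := by
  have hlt : ∀ {k : Multiset (Fin t)}, k.card < b → ∀ s, k.count s < b :=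
    fun hk s => (Multiset.count_le_card s _).trans_lt hk
  have hsum : ∀ (k : Multiset (Fin t)) (hk : k.card < b),
      (k.map fun s : Fin t => b ^ (s : ℕ)).sum
        = (finFunctionFinEquiv fun s => (⟨k.count s, hlt hk s⟩ : Fin b) : ℕ) := by
    intro k hk
    rw [finFunctionFinEquiv_apply, Finset.sum_multiset_map_count]
    simp only [smul_eq_mul]
    refine Finset.sum_subset (Finset.subset_univ _) fun s _ hs => ?_
    rw [Multiset.count_eq_zero_of_notMem fun h => hs (Multiset.mem_toFinset.2 h), zero_mul]
  rw [hsum k hk, hsum k' hk'] at h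
  have hf := finFunctionFinEquiv.injective (Fin.ext h)
  ext s
  exact congrArg Fin.val (congrFun hf s)

theorem Multiset.prod_map_mul_pow {t B : ℕ} (k : Multiset (Fin t)) (v : Fin t → ℤ)
    (e : Fin t → ℕ) : (k.map fun s => v s * (B : ℤ) ^ e s).prod
      = (k.map v).prod * (B : ℤ) ^ (k.map e).sum := by
  induction k using Multiset.induction_on with
  | empty => simp
  | cons a k ih =>
    simp only [Multiset.map_cons, Multiset.prod_cons, Multiset.sum_cons, ih, pow_add]
    ring

theorem Multiset.abs_prod_map_le_one {t : ℕ} (k : Multiset (Fin t)) (v : Fin t → ℤ)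
    (hv : ∀ s, |v s| ≤ 1) : |(k.map v).prod| ≤ 1 := by
  induction k using Multiset.induction_on with
  | empty => simp
  | cons a k ih =>
    rw [Multiset.map_cons, Multiset.prod_cons, abs_mul]
    exact mul_le_one₀ (hv a) (abs_nonneg _) ih

/-- In `c B ^ e / (A B ^ e₀)` a higher exponent `e > e₀` leaves an integer, a lower one a small
number. -/
theorem UnitAddCircle.norm_div_pow_le {A B c : ℤ} (hB : 0 < B) (hA : A ≠ 0) (hAB : A ∣ B)
    {e e₀ : ℕ} (he : e ≠ e₀) :
    ‖((c * B ^ e / (A * B ^ e₀) : ℝ) : UnitAddCircle)‖ ≤ |(c : ℝ)| / B := by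
  have hBR : (0 : ℝ) < B := by exact_mod_cast hB
  have hAR : (A : ℝ) ≠ 0 := by exact_mod_cast hA
  obtain ⟨q, hq⟩ := hAB
  rcases lt_or_gt_of_ne he with h | h
  · obtain ⟨i, rfl⟩ := Nat.exists_eq_add_of_lt h
    refine (UnitAddCircle.norm_coe_le_abs _).trans ?_
    have hA1 : (1 : ℝ) ≤ |(A : ℝ)| := by exact_mod_cast Int.one_le_abs hA
    have hB1 : (1 : ℝ) ≤ B := by exact_mod_cast hB
    have hBi : (1 : ℝ) ≤ (B : ℝ) ^ i := one_le_pow₀ hB1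
    have : (c * B ^ e / (A * B ^ (e + i + 1)) : ℝ) = c / (A * (B ^ i * B)) := by
      field_simp
      ring
    rw [this, abs_div]
    refine div_le_div_of_nonneg_left (abs_nonneg _) hBR ?_
    rw [abs_mul, abs_mul, abs_pow, abs_of_pos hBR]
    nlinarith [mul_le_mul hA1 hBi zero_le_one (abs_nonneg _)]
  · obtain ⟨i, rfl⟩ := Nat.exists_eq_add_of_lt h
    have : (c * B ^ (e₀ + i + 1) / (A * B ^ e₀) : ℝ) = ((c * B ^ i * q : ℤ) : ℝ) := by
      have hBA : (B : ℝ) = A * q := by exact_mod_cast hq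
      rw [div_eq_iff (by positivity)]
      push_cast
      rw [pow_succ, pow_add]
      nth_rewrite 3 [hBA]
      ring
    rw [this, UnitAddCircle.coe_intCast, norm_zero]
    positivity

/-- The multinomial expansion of an integer polynomial at a sum of multiples of powers of `B`. -/
theorem Polynomial.eval_sum_mul_pow (p : Polynomial ℤ) {t : ℕ} (B : ℕ) (e : Fin t → ℕ)
    (v : Fin t → ℤ) :
    p.eval (∑ s, v s * (B : ℤ) ^ e s)
      = ∑ x ∈ (Finset.range (p.natDegree + 1)).sigma
          fun j => (Finset.univ : Finset (Fin t)).sym j,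
        p.coeff x.1 * (Multiset.countPerms (x.2 : Multiset (Fin t)))
          * (((x.2 : Multiset (Fin t)).map v).prod)
          * (B : ℤ) ^ (((x.2 : Multiset (Fin t)).map e).sum) := by
  rw [Polynomial.eval_eq_sum_range, Finset.sum_sigma]
  refine Finset.sum_congr rfl fun j _ => ?_
  rw [Finset.sum_pow, Finset.mul_sum]
  refine Finset.sum_congr rfl fun k _ => ?_
  rw [Multiset.prod_map_mul_pow]
  simp only [Sym.val_eq_coe]
  ring

theorem Multiset.countPerms_pos {α : Type*} [DecidableEq α] (k : Multiset α) :
    0 < k.countPerms := Nat.multinomial_pos _ _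

/-- Positive powers of `a ∈ {0, ±1}` have the parity of `a`. -/
theorem UnitAddCircle.coe_pow_mul_div_two {a b : ℤ} (ha : a = 0 ∨ a = 1 ∨ a = -1) {d : ℕ}
    (hd : d ≠ 0) : (((a ^ d * b : ℤ) / 2 : ℝ) : UnitAddCircle) = ((a * b : ℤ) / 2 : ℝ) := by
  have h : (2 : ℤ) ∣ a ^ d * b - a * b := by
    rw [← sub_mul]
    refine Dvd.dvd.mul_right ?_ _
    rcases ha with rfl | rfl | rfl
    · simp [hd]
    · simp
    · rcases neg_one_pow_eq_or ℤ d with h | h <;> rw [h] <;> norm_num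
  obtain ⟨z, hz⟩ := h
  rw [← sub_eq_zero, ← AddCircle.coe_sub]
  have : ((a ^ d * b : ℤ) / 2 - (a * b : ℤ) / 2 : ℝ) = (z : ℤ) := by
    rw [← sub_div, ← Int.cast_sub, hz]
    push_cast
    ring
  rw [this, UnitAddCircle.coe_intCast]

/-- Placing the `n s` at the powers `B ^ (d + 1) ^ s` separates the monomials of
`p (∑ s, v s * n s)`. Dividing by twice the coefficient of the monomial `v r ^ (d - 1) * v s`
isolates this monomial modulo `1`: the higher ones become integers and the lower ones small. -/
theorem exists_isolating_frequencies (p : Polynomial ℤ) (hp : 1 < p.natDegree) (t N : ℕ)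
    (hN : 0 < N) {ε : ℝ} (hε : 0 < ε) :
    ∃ (n : Fin t → ℕ) (y : Fin t → Fin t → ℝ) (D : ℕ), 0 < D ∧ (∀ s, 0 < n s ∧ N ∣ n s) ∧
      (∀ r s, |y r s| ≤ ε) ∧ (∀ r s, ∃ z : ℤ, D * y r s = z) ∧
      ∀ v : Fin t → ℤ, (∀ s, v s = 0 ∨ v s = 1 ∨ v s = -1) → ∀ r s,
        ‖((p.eval (∑ s, v s * (n s : ℤ)) * y r s - (v r * v s : ℤ) / 2 : ℝ) : UnitAddCircle)‖
          ≤ ε := by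
  set d := p.natDegree with hd
  set S := (Finset.range (d + 1)).sigma fun j => (Finset.univ : Finset (Fin t)).sym j with hS
  let α : Fin t → Fin t → Multiset (Fin t) := fun r s => s ::ₘ Multiset.replicate (d - 1) r
  have hα : ∀ r s, (α r s).card = d := by
    intro r s
    simp only [α, Multiset.card_cons, Multiset.card_replicate]
    omega
  have ha : p.coeff d ≠ 0 := by
    rw [hd, Polynomial.coeff_natDegree, Polynomial.leadingCoeff_ne_zero]
    intro h
    rw [hd, h, Polynomial.natDegree_zero] at hp
    omega
  let A : Fin t → Fin t → ℤ := fun r s => 2 * (p.coeff d * (α r s).countPerms)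
  have hA : ∀ r s, A r s ≠ 0 := fun r s => mul_ne_zero two_ne_zero
    (mul_ne_zero ha (by exact_mod_cast ((α r s).countPerms_pos).ne'))
  let W : ℕ := ∏ r, ∏ s, (A r s).natAbs
  have hW : 0 < W := Finset.prod_pos fun r _ => Finset.prod_pos fun s _ =>
    Int.natAbs_pos.2 (hA r s)
  have hAW : ∀ r s, A r s ∣ (W : ℤ) := fun r s => Int.natAbs_dvd.1 (Int.natCast_dvd_natCast.2
    ((Finset.dvd_prod_of_mem (fun s => (A r s).natAbs) (Finset.mem_univ s)).trans
      (Finset.dvd_prod_of_mem (fun r => ∏ s, (A r s).natAbs) (Finset.mem_univ r))))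
  let K : ℝ := ∑ x ∈ S, |(p.coeff x.1 : ℝ)| * (Multiset.countPerms (x.2 : Multiset (Fin t)))
  have hK : 0 ≤ K := Finset.sum_nonneg fun x _ => by positivity
  obtain ⟨M, hM⟩ := exists_nat_gt ((K + 1) / ε)
  have hM0 : 0 < M := by
    have : (0 : ℝ) < M := lt_trans (by positivity) hM
    exact_mod_cast this
  -- `W` makes the higher monomials integral, `N` gives divisibility, `M` makes the errors small
  set B : ℕ := W * N * M with hB
  have hB0 : 0 < B := by positivity
  have hBM : (M : ℝ) ≤ B := by
    exact_mod_cast Nat.le_mul_of_pos_left M (by positivity : 0 < W * N)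
  have hBR : (0 : ℝ) < B := by exact_mod_cast hB0
  have hB1 : (1 : ℝ) ≤ B := by exact_mod_cast hB0
  have hKB : (K + 1) / B ≤ ε := by
    rw [div_le_iff₀ hBR]
    rw [div_lt_iff₀ hε] at hM
    nlinarith
  have hAB : ∀ r s, A r s ∣ ((B : ℕ) : ℤ) := fun r s => (hAW r s).trans (by
    rw [hB]
    push_cast
    rw [mul_assoc]
    exact dvd_mul_right _ _)
  let e : Fin t → ℕ := fun s => (d + 1) ^ (s : ℕ)
  let E : Fin t → Fin t → ℕ := fun r s => ((α r s).map e).sum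
  have hE : ∀ r s, 1 ≤ E r s := by
    intro r s
    simp only [E, α, Multiset.map_cons, Multiset.sum_cons]
    have : 0 < e s := by positivity
    omega
  refine ⟨fun s => B ^ e s, fun r s => 1 / (A r s * B ^ E r s),
    ∏ r, ∏ s, ((A r s).natAbs * B ^ E r s), ?_, ?_, ?_, ?_, ?_⟩
  · exact Finset.prod_pos fun r _ => Finset.prod_pos fun s _ =>
      Nat.mul_pos (Int.natAbs_pos.2 (hA r s)) (by positivity)
  · intro s
    refine ⟨by positivity, dvd_pow ?_ (by positivity)⟩
    exact ⟨W * M, by rw [hB]; ring⟩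
  · intro r s
    have hA1 : (1 : ℝ) ≤ |(A r s : ℝ)| := by exact_mod_cast Int.one_le_abs (hA r s)
    have hBE : (B : ℝ) ≤ (B : ℝ) ^ E r s := le_self_pow₀ hB1 (by have := hE r s; omega)
    rw [abs_div, abs_one, abs_mul, abs_of_pos (pow_pos hBR _)]
    refine le_trans ?_ hKB
    refine div_le_div₀ (by positivity) (by linarith) hBR ?_
    nlinarith
  · intro r s
    have hdvd : A r s * (B : ℤ) ^ E r s
        ∣ ((∏ r, ∏ s, ((A r s).natAbs * B ^ E r s) : ℕ) : ℤ) := by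
      rw [← Int.natAbs_dvd, Int.natCast_dvd_natCast, Int.natAbs_mul, Int.natAbs_pow,
        Int.natAbs_natCast]
      exact (Finset.dvd_prod_of_mem (fun s => (A r s).natAbs * B ^ E r s)
        (Finset.mem_univ s)).trans (Finset.dvd_prod_of_mem
          (fun r => ∏ s, ((A r s).natAbs * B ^ E r s)) (Finset.mem_univ r))
    obtain ⟨z, hz⟩ := hdvd
    refine ⟨z, ?_⟩
    have hAR : (A r s : ℝ) ≠ 0 := by exact_mod_cast hA r s
    rw [mul_one_div, div_eq_iff (by positivity), mul_comm (z : ℝ)]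
    have hzR := congrArg (Int.cast : ℤ → ℝ) hz
    rw [Int.cast_natCast] at hzR
    rw [hzR]
    push_cast
    ring
  · intro v hv r s
    have hAR : (A r s : ℝ) ≠ 0 := by exact_mod_cast hA r s
    have hv1 : ∀ s, |v s| ≤ 1 := by
      intro s
      rcases hv s with h | h | h <;> simp [h]
    let c : (Σ j, Sym (Fin t) j) → ℤ := fun x =>
      p.coeff x.1 * (Multiset.countPerms (x.2 : Multiset (Fin t)))
        * (((x.2 : Multiset (Fin t)).map v).prod)
    let Ex : (Σ j, Sym (Fin t) j) → ℕ := fun x => ((x.2 : Multiset (Fin t)).map e).sum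
    let τ : (Σ j, Sym (Fin t) j) → ℝ := fun x => c x * B ^ Ex x / (A r s * B ^ E r s)
    have hexp : ((p.eval (∑ s, v s * ((B ^ e s : ℕ) : ℤ)) : ℤ) : ℝ) * (1 / (A r s * B ^ E r s))
        = ∑ x ∈ S, τ x := by
      have := Polynomial.eval_sum_mul_pow p B e v
      push_cast at this ⊢
      rw [this]
      push_cast
      rw [Finset.sum_mul]
      refine Finset.sum_congr rfl fun x _ => ?_
      simp only [τ, c, Ex]
      push_cast
      ring
    let x₀ : Σ j, Sym (Fin t) j := ⟨d, ⟨α r s, hα r s⟩⟩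
    have hx₀ : x₀ ∈ S := Finset.mem_sigma.2 ⟨Finset.mem_range.2 (Nat.lt_succ_self d),
      Finset.mem_sym_iff.2 fun _ _ => Finset.mem_univ _⟩
    have hτ₀ : τ x₀ = ((v r ^ (d - 1) * v s : ℤ) : ℝ) / 2 := by
      have hc : c x₀ * 2 = A r s * (v r ^ (d - 1) * v s) := by
        simp only [c, x₀, A, Sym.coe_mk, α, Multiset.map_cons, Multiset.map_replicate,
          Multiset.prod_cons, Multiset.prod_replicate]
        ring
      have hcR : (c x₀ : ℝ) * 2 = A r s * ((v r ^ (d - 1) * v s : ℤ) : ℝ) := by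
        exact_mod_cast hc
      have hEx : Ex x₀ = E r s := rfl
      simp only [τ, hEx]
      rw [mul_div_mul_right _ _ (by positivity), div_eq_div_iff hAR two_ne_zero, hcR]
      ring
    have hne : ∀ x ∈ S.erase x₀, Ex x ≠ E r s := by
      rintro ⟨j, k⟩ hx hxE
      obtain ⟨hx1, hx2⟩ := Finset.mem_erase.1 hx
      have hj : j < d + 1 := Finset.mem_range.1 (Finset.mem_sigma.1 hx2).1
      have hk : (k : Multiset (Fin t)) = α r s := Multiset.eq_of_sum_map_pow_eq (b := d + 1)
        (by rw [Sym.card_coe]; exact hj) (by rw [hα]; exact Nat.lt_succ_self d) hxE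
      have hjd : j = d := by rw [← hα r s, ← hk, Sym.card_coe]
      subst hjd
      exact hx1 (congrArg (Sigma.mk d) (Subtype.ext hk))
    have hpar : ((((v r ^ (d - 1) * v s : ℤ) : ℝ) / 2 : ℝ) : UnitAddCircle)
        = (((v r * v s : ℤ) : ℝ) / 2 : ℝ) :=
      UnitAddCircle.coe_pow_mul_div_two (hv r) (by omega)
    rw [hexp, ← Finset.add_sum_erase S τ hx₀, hτ₀, AddCircle.coe_sub, AddCircle.coe_add, hpar,
      add_sub_cancel_left]
    have hcoe : ((∑ x ∈ S.erase x₀, τ x : ℝ) : UnitAddCircle)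
        = ∑ x ∈ S.erase x₀, (τ x : UnitAddCircle) :=
      map_sum (QuotientAddGroup.mk' (AddSubgroup.zmultiples (1 : ℝ))) τ _
    rw [hcoe]
    refine (norm_sum_le _ _).trans (le_trans ?_ hKB)
    calc ∑ x ∈ S.erase x₀, ‖(τ x : UnitAddCircle)‖
        ≤ ∑ x ∈ S.erase x₀, |(p.coeff x.1 : ℝ)|
            * (Multiset.countPerms (x.2 : Multiset (Fin t))) / B := by
          refine Finset.sum_le_sum fun x hx => ?_
          have h1 := UnitAddCircle.norm_div_pow_le (c := c x) (B := (B : ℕ))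
            (by exact_mod_cast hB0) (hA r s) (hAB r s) (hne x hx)
          refine (h1.trans ?_)
          push_cast
          refine div_le_div_of_nonneg_right ?_ hBR.le
          have h2 : |((((x.2 : Multiset (Fin t)).map v).prod : ℤ) : ℝ)| ≤ 1 := by
            exact_mod_cast Multiset.abs_prod_map_le_one (x.2 : Multiset (Fin t)) v hv1
          simp only [c]
          push_cast at h2 ⊢
          rw [abs_mul, abs_mul, Nat.abs_cast]
          exact mul_le_of_le_one_right (by positivity) h2
      _ ≤ ∑ x ∈ S, |(p.coeff x.1 : ℝ)|
            * (Multiset.countPerms (x.2 : Multiset (Fin t))) / B :=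
          Finset.sum_le_sum_of_subset_of_nonneg (Finset.erase_subset _ _) fun x _ _ => by positivity
      _ = K / B := by rw [← Finset.sum_div]
      _ ≤ (K + 1) / B := div_le_div_of_nonneg_right (by linarith) hBR.le

/-! ### Random quadratic forms over the field with two elements -/

/-- Pairs `(L₁, L₂)` of linear forms on `𝔽₂ᵗ`, given by their pairs of coefficients. -/
abbrev FormPair (t : ℕ) : Type := Fin t → ZMod 2 × ZMod 2

namespace FormPair

/-- The values `(L₁ v, L₂ v)`. -/
def value {t : ℕ} (v : Fin t → ℤ) (ω : FormPair t) : ZMod 2 × ZMod 2 :=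
  ∑ s, (v s : ZMod 2) • ω s

/-- The coefficient in `{0, 1}` of `v r * v s` in `L₁² + L₁ L₂ + L₂²`. -/
def coeff {t : ℕ} (ω : FormPair t) (r s : Fin t) : ℤ :=
  ((ω r).1 * (ω s).1 + (ω r).1 * (ω s).2 + (ω r).2 * (ω s).2 : ZMod 2).val

/-- An integral lift of the quadratic form `L₁² + L₁ L₂ + L₂²` over `𝔽₂`. -/
def quad {t : ℕ} (ω : FormPair t) (v : Fin t → ℤ) : ℤ := ∑ r, ∑ s, ω.coeff r s * (v r * v s)

theorem coeff_nonneg {t : ℕ} (ω : FormPair t) (r s : Fin t) : 0 ≤ ω.coeff r s :=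
  Int.natCast_nonneg _

theorem coeff_le_one {t : ℕ} (ω : FormPair t) (r s : Fin t) : ω.coeff r s ≤ 1 := by
  have := ZMod.val_lt ((ω r).1 * (ω s).1 + (ω r).1 * (ω s).2 + (ω r).2 * (ω s).2 : ZMod 2)
  unfold coeff
  omega

/-- The norm form of `𝔽₄` over `𝔽₂`; it vanishes only at the origin. -/
def normForm (z : ZMod 2 × ZMod 2) : ZMod 2 := z.1 * z.1 + z.1 * z.2 + z.2 * z.2

theorem quad_cast {t : ℕ} (ω : FormPair t) (v : Fin t → ℤ) :
    (ω.quad v : ZMod 2) = normForm (value v ω) := by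
  have h1 : (value v ω).1 = ∑ s, (v s : ZMod 2) * (ω s).1 := by
    simp [value, Prod.fst_sum]
  have h2 : (value v ω).2 = ∑ s, (v s : ZMod 2) * (ω s).2 := by
    simp [value, Prod.snd_sum]
  rw [normForm, h1, h2, Finset.sum_mul_sum, Finset.sum_mul_sum, Finset.sum_mul_sum,
    ← Finset.sum_add_distrib, ← Finset.sum_add_distrib, quad, Int.cast_sum]
  refine Finset.sum_congr rfl fun r _ => ?_
  rw [← Finset.sum_add_distrib, ← Finset.sum_add_distrib, Int.cast_sum]
  refine Finset.sum_congr rfl fun s _ => ?_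
  simp only [coeff, Int.cast_mul, Int.cast_natCast, ZMod.natCast_zmod_val]
  ring

/-- The real character `(-1) ^ z` of `𝔽₂`. -/
def sign (z : ZMod 2) : ℝ := if z = 0 then 1 else -1

/-- If some `v i` is odd then `(L₁ v, L₂ v)` is uniformly distributed on `𝔽₂²`, and the norm form
is nonzero at three of the four points there. -/
theorem sum_sign_quad {t : ℕ} (v : Fin t → ℤ) {i : Fin t} (hi : (v i : ZMod 2) = 1) :
    ∑ ω : FormPair t, sign (ω.quad v) = -(Fintype.card (FormPair t) : ℝ) / 2 := by
  simp_rw [quad_cast]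
  -- translating the `i`-th coefficients by `a` translates `(L₁ v, L₂ v)` by `a`
  have hshift : ∀ a : ZMod 2 × ZMod 2, ∑ ω : FormPair t, sign (normForm (value v ω))
      = ∑ ω : FormPair t, sign (normForm (value v ω + a)) := by
    intro a
    refine (Equiv.sum_comp (Equiv.addRight (Pi.single i a : FormPair t))
      fun ω => sign (normForm (value v ω))).symm.trans ?_
    refine Finset.sum_congr rfl fun ω _ => ?_
    congr 2
    change ∑ s, (v s : ZMod 2) • (ω s + (Pi.single i a : Fin t → ZMod 2 × ZMod 2) s) = _
    simp_rw [smul_add]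
    rw [Finset.sum_add_distrib]
    congr 1
    rw [Finset.sum_eq_single i (fun s _ hs => by rw [Pi.single_eq_of_ne hs, smul_zero])
      (fun h => absurd (Finset.mem_univ i) h), Pi.single_eq_same, hi, one_smul]
  have hfour : ∀ b : ZMod 2 × ZMod 2, ∑ a, sign (normForm (b + a)) = -2 := by
    intro b
    refine (Equiv.sum_comp (Equiv.addLeft b) fun a => sign (normForm a)).trans ?_
    rw [Fintype.sum_prod_type]
    change (∑ x : Fin 2, ∑ y : Fin 2, sign (normForm (x, y))) = -2
    simp only [Fin.sum_univ_two]
    have e : ∀ x y : Fin 2, sign (normForm (x, y))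
      = if (x, y) = ((0, 0) : Fin 2 × Fin 2) then 1 else -1 := by
      intro x y
      have : normForm (x, y) = 0 ↔ (x, y) = ((0, 0) : Fin 2 × Fin 2) := by
        revert x y
        decide
      simp only [sign, this]
    simp only [e]
    norm_num
  -- average over the four translations that change `(L₁ v, L₂ v)` by `a`
  have h4 : (4 : ℝ) * ∑ ω : FormPair t, sign (normForm (value v ω))
      = ∑ a : ZMod 2 × ZMod 2, ∑ ω : FormPair t, sign (normForm (value v ω + a)) := by
    rw [← Finset.sum_congr rfl fun a _ => hshift a, Finset.sum_const, Finset.card_univ,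
      Fintype.card_prod, ZMod.card, nsmul_eq_mul]
    norm_num
  rw [Finset.sum_comm, Finset.sum_congr rfl fun ω _ => hfour _, Finset.sum_const,
    Finset.card_univ, nsmul_eq_mul] at h4
  linarith

theorem re_toCircle_div_two (z : ℤ) :
    (AddCircle.toCircle (((z : ℝ) / 2 : ℝ) : UnitAddCircle) : ℂ).re = sign z := by
  rw [AddCircle.toCircle_apply_mk, Circle.coe_exp, Complex.exp_ofReal_mul_I_re]
  have h : 2 * Real.pi / 1 * ((z : ℝ) / 2) = z * Real.pi := by ring
  rw [h, Real.cos_int_mul_pi, sign]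
  split_ifs with h0
  · have : Even z := (ZMod.intCast_eq_zero_iff_even).1 h0
    exact this.neg_one_zpow
  · have : Odd z := Int.not_even_iff_odd.1 fun h => h0 ((ZMod.intCast_eq_zero_iff_even).2 h)
    exact this.neg_one_zpow

end FormPair

/-! ### The stages of the construction -/

/-- One stage of the construction: `X ω` is a point of the circle at which the phases
`p (∑ s, v s * n s) • X ω` are nearly those of the quadratic form attached to `ω`. -/
theorem exists_stage (p : Polynomial ℤ) (hp : 1 < p.natDegree) (t N : ℕ) (hN : 0 < N) :
    ∃ (n : Fin t → ℕ) (X : FormPair t → UnitAddCircle) (N' : ℕ), 0 < N' ∧ N ∣ N' ∧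
      (∀ s, 0 < n s ∧ N ∣ n s) ∧ (∀ ω, N' • X ω = 0) ∧ (∀ ω, N * ‖X ω‖ ≤ (1 / 2) ^ t) ∧
      (∀ v : Fin t → ℤ, (∀ s, v s = 0 ∨ v s = 1 ∨ v s = -1) →
        |p.eval (∑ s, v s * (n s : ℤ))| ≤ N' ∧ ∀ ω : FormPair t,
        ‖p.eval (∑ s, v s * (n s : ℤ)) • X ω - (((ω.quad v : ℝ) / 2 : ℝ) : UnitAddCircle)‖
          ≤ (1 / 2) ^ t) := by
  have hNR : (1 : ℝ) ≤ N := by exact_mod_cast hN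
  set ε : ℝ := (1 / 2) ^ t / (N * (t * t + 1)) with hε
  have hε0 : 0 < ε := by positivity
  have hεt : ∑ _r : Fin t, ∑ _s : Fin t, ε ≤ (1 / 2) ^ t / N := by
    simp only [Finset.sum_const, Finset.card_univ, Fintype.card_fin, nsmul_eq_mul]
    rw [hε, div_mul_eq_div_div, ← mul_assoc, mul_div_assoc', div_le_iff₀ (by positivity)]
    have : (0 : ℝ) ≤ (1 / 2) ^ t / N := by positivity
    nlinarith
  obtain ⟨n, y, D, hD, hn, hy, hDy, happrox⟩ := exists_isolating_frequencies p hp t N hN hε0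
  -- in `N * D * C` the factor `D` kills the new points and `C` dominates the times of this stage
  let V : Finset (Fin t → ℤ) := Fintype.piFinset fun _ => {0, 1, -1}
  let C : ℕ := 1 + ∑ v ∈ V, (p.eval (∑ s, v s * (n s : ℤ))).natAbs
  let x : FormPair t → ℝ := fun ω => ∑ r, ∑ s, ω.coeff r s * y r s
  have hcoeff : ∀ (ω : FormPair t) r s, |(ω.coeff r s : ℝ)| ≤ 1 := fun ω r s => by
    rw [abs_le]
    have h1 : (0 : ℝ) ≤ ω.coeff r s := by exact_mod_cast ω.coeff_nonneg r s
    have h2 : (ω.coeff r s : ℝ) ≤ 1 := by exact_mod_cast ω.coeff_le_one r s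
    exact ⟨by linarith, h2⟩
  have hND : 0 < N * D * C := by positivity
  refine ⟨n, fun ω => (x ω : UnitAddCircle), N * D * C, hND, ⟨D * C, by ring⟩, hn,
    fun ω => ?_, fun ω => ?_, fun v hv => ⟨?_, fun ω => ?_⟩⟩
  · choose z hz using hDy
    rw [← AddCircle.coe_nsmul, nsmul_eq_mul]
    have : ((N * D * C : ℕ) : ℝ) * x ω
        = ((N * C * ∑ r, ∑ s, ω.coeff r s * z r s : ℤ) : ℝ) := by
      push_cast
      simp_rw [← hz, x, Finset.mul_sum]
      refine Finset.sum_congr rfl fun r _ => Finset.sum_congr rfl fun s _ => by ring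
    rw [this, UnitAddCircle.coe_intCast]
  · have hx : |x ω| ≤ (1 / 2) ^ t / N := by
      refine le_trans ?_ hεt
      refine (Finset.abs_sum_le_sum_abs _ _).trans (Finset.sum_le_sum fun r _ => ?_)
      refine (Finset.abs_sum_le_sum_abs _ _).trans (Finset.sum_le_sum fun s _ => ?_)
      rw [abs_mul]
      exact (mul_le_of_le_one_left (abs_nonneg _) (hcoeff ω r s)).trans (hy r s)
    have h2 := (UnitAddCircle.norm_coe_le_abs (x ω)).trans hx
    rw [le_div_iff₀ (by linarith)] at h2
    linarith
  · have hvV : v ∈ V := Fintype.mem_piFinset.2 fun s => by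
      rcases hv s with h | h | h <;> simp [h]
    have h1 := Finset.single_le_sum
      (f := fun v : Fin t → ℤ => (p.eval (∑ s, v s * (n s : ℤ))).natAbs)
      (fun _ _ => Nat.zero_le _) hvV
    have h2 : (p.eval (∑ s, v s * (n s : ℤ))).natAbs ≤ N * D * C :=
      (h1.trans (Nat.le_add_left _ 1)).trans (Nat.le_mul_of_pos_left C (by positivity))
    rw [Int.abs_eq_natAbs]
    exact_mod_cast h2
  · set k := p.eval (∑ s, v s * (n s : ℤ)) with hk
    rw [← AddCircle.coe_zsmul, ← AddCircle.coe_sub, zsmul_eq_mul]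
    have hsum : (k : ℝ) * x ω - (ω.quad v : ℝ) / 2
        = ∑ r, ∑ s, ω.coeff r s • (k * y r s - (v r * v s : ℤ) / 2 : ℝ) := by
      simp only [x, FormPair.quad, Int.cast_sum, Finset.mul_sum, Finset.sum_div,
        ← Finset.sum_sub_distrib]
      refine Finset.sum_congr rfl fun r _ => Finset.sum_congr rfl fun s _ => ?_
      rw [zsmul_eq_mul]
      push_cast
      ring
    have hcoe : ∀ f : Fin t → ℝ, ((∑ r, f r : ℝ) : UnitAddCircle) = ∑ r, (f r : UnitAddCircle) :=
      fun f => map_sum (QuotientAddGroup.mk' (AddSubgroup.zmultiples (1 : ℝ))) f _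
    rw [hsum, hcoe]
    refine le_trans ?_ (hεt.trans (div_le_self (by positivity) hNR))
    refine norm_sum_le_of_le _ fun r _ => ?_
    rw [hcoe]
    refine norm_sum_le_of_le _ fun s _ => ?_
    rw [AddCircle.coe_zsmul]
    refine (norm_zsmul_le _ _).trans ?_
    refine (mul_le_of_le_one_left (norm_nonneg _) ?_).trans (happrox v hv r s)
    rw [Int.norm_eq_abs]
    exact hcoeff ω r s

/-! ### The spectral measure -/

/-- The stages fitted together: at the times of stage `t` the points of the earlier stages are
invisible, because the times are multiples of their orders, and those of the later stages are
negligible, because they are chosen small after these times are known. -/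
theorem exists_stage_sequence (p : Polynomial ℤ) (hp0 : p.eval 0 = 0) (hp : 1 < p.natDegree) :
    ∃ (n : (t : ℕ) → Fin t → ℕ) (X : (t : ℕ) → FormPair t → UnitAddCircle),
      (∀ t s, 0 < n t s) ∧ (∀ t ω, ‖X t ω‖ ≤ (1 / 2) ^ t) ∧
      ∀ t (v : Fin t → ℤ), (∀ s, v s = 0 ∨ v s = 1 ∨ v s = -1) →
        (∀ τ < t, ∀ ω, p.eval (∑ s, v s * (n t s : ℤ)) • X τ ω = 0) ∧
        (∀ ω : FormPair t, ‖p.eval (∑ s, v s * (n t s : ℤ)) • X t ω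
          - (((ω.quad v : ℝ) / 2 : ℝ) : UnitAddCircle)‖ ≤ (1 / 2) ^ t) ∧
        ∀ τ, t < τ → ∀ ω, ‖p.eval (∑ s, v s * (n t s : ℤ)) • X τ ω‖ ≤ (1 / 2) ^ τ := by
  choose n X N' hN' hdvd hn hX0 hXs hX using fun (t : ℕ) (N : {N : ℕ // 0 < N}) =>
    exists_stage p hp t N.1 N.2
  let M : ℕ → {N : ℕ // 0 < N} := fun t =>
    Nat.rec ⟨1, one_pos⟩ (fun t N => ⟨N' t N, hN' t N⟩) t
  have hM : ∀ t, (M (t + 1)).1 = N' t (M t) := fun t => rfl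
  have hMdvd : ∀ {s t}, s ≤ t → (M s).1 ∣ (M t).1 := by
    intro s t hst
    induction t, hst using Nat.le_induction with
    | base => exact dvd_refl _
    | succ t _ ih => exact ih.trans (by rw [hM]; exact hdvd t (M t))
  refine ⟨fun t => n t (M t), fun t => X t (M t), fun t s => (hn t (M t) s).1, fun t ω => ?_,
    fun t v hv => ⟨fun τ hτ ω => ?_, fun ω => (hX t (M t) v hv).2 ω, fun τ hτ ω => ?_⟩⟩
  · have h1 : (1 : ℝ) ≤ (M t).1 := by exact_mod_cast (M t).2
    exact (le_mul_of_one_le_left (norm_nonneg _) h1).trans (hXs t (M t) ω)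
  · have h1 : ((M (τ + 1)).1 : ℤ) ∣ p.eval (∑ s, v s * (n t (M t) s : ℤ)) := by
      have h2 : ((M (τ + 1)).1 : ℤ) ∣ ∑ s, v s * (n t (M t) s : ℤ) :=
        Finset.dvd_sum fun s _ => Dvd.dvd.mul_left
          (Int.natCast_dvd_natCast.2 ((hMdvd hτ).trans (hn t (M t) s).2)) _
      have h3 := Polynomial.sub_dvd_eval_sub (∑ s, v s * (n t (M t) s : ℤ)) 0 p
      rw [hp0, sub_zero, sub_zero] at h3
      exact h2.trans h3
    obtain ⟨q, hq⟩ := h1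
    rw [hq, mul_comm, mul_zsmul, natCast_zsmul, hM, hX0, smul_zero]
  · refine (norm_zsmul_le _ _).trans (le_trans ?_ (hXs τ (M τ) ω))
    refine mul_le_mul_of_nonneg_right ?_ (norm_nonneg _)
    rw [Int.norm_eq_abs]
    have h1 : |p.eval (∑ s, v s * (n t (M t) s : ℤ))| ≤ ((M τ).1 : ℤ) :=
      (hX t (M t) v hv).1.trans
        (by exact_mod_cast Nat.le_of_dvd (M τ).2 (hMdvd (s := t + 1) hτ))
    exact_mod_cast h1

/-- The chord between two points of the unit circle is shorter than the arc. -/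
theorem UnitAddCircle.norm_toCircle_sub_le (x y : UnitAddCircle) :
    ‖(AddCircle.toCircle x : ℂ) - AddCircle.toCircle y‖ ≤ 2 * Real.pi * ‖x - y‖ := by
  have h1 : ∀ z : UnitAddCircle, ‖(AddCircle.toCircle z : ℂ) - 1‖ ≤ 2 * Real.pi * ‖z‖ := by
    intro z
    induction z using QuotientAddGroup.induction_on with
    | H u =>
      have hu : ((u - round u : ℝ) : UnitAddCircle) = (u : UnitAddCircle) := by
        rw [AddCircle.coe_sub, UnitAddCircle.coe_intCast, sub_zero]
      have hnorm : ‖(u : UnitAddCircle)‖ = |u - round u| := UnitAddCircle.norm_eq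
      change ‖(AddCircle.toCircle (u : UnitAddCircle) : ℂ) - 1‖
        ≤ 2 * Real.pi * ‖(u : UnitAddCircle)‖
      rw [hnorm, ← hu, AddCircle.toCircle_apply_mk, Circle.coe_exp, mul_comm (_ : ℂ) Complex.I]
      refine Real.norm_exp_I_mul_ofReal_sub_one_le.trans (le_of_eq ?_)
      rw [Real.norm_eq_abs, abs_mul, div_one, abs_of_pos Real.two_pi_pos]
  have h2 : (AddCircle.toCircle x : ℂ) = AddCircle.toCircle (x - y) * AddCircle.toCircle y := by
    rw [← Circle.coe_mul, ← AddCircle.toCircle_add, sub_add_cancel]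
  rw [h2, ← sub_one_mul, norm_mul, Circle.norm_coe, mul_one]
  exact h1 _

/-- Averaging a measure with its reflection replaces its Fourier coefficients by their real
parts. -/
theorem exists_symmetrization (ν : Measure UnitAddCircle) [IsProbabilityMeasure ν] :
    ∃ ρ : Measure UnitAddCircle, IsProbabilityMeasure ρ ∧
      (∀ n, spectralCoeff ρ n = spectralCoeff ρ (-n)) ∧
      ∀ n, (spectralCoeff ρ n).re = (spectralCoeff ν n).re := by
  have hm : Measurable (fun x : UnitAddCircle => -x) := measurable_neg
  have hprob := Measure.isProbabilityMeasure_map (μ := ν) hm.aemeasurable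
  let ρ : Measure UnitAddCircle := (2 : ENNReal)⁻¹ • ν + (2 : ENNReal)⁻¹ • ν.map (fun x => -x)
  have hint : ∀ (μ : Measure UnitAddCircle) [IsFiniteMeasure μ] (n : ℤ),
      Integrable (fun x => (fourier n x : ℂ)) μ := fun μ _ n =>
    (fourier n).continuous.integrable_of_hasCompactSupport (HasCompactSupport.of_compactSpace _)
  have hρ : ∀ n, spectralCoeff ρ n = 2⁻¹ * (spectralCoeff ν n + spectralCoeff ν (-n)) := by
    intro n
    have htop : (2 : ENNReal)⁻¹ ≠ ⊤ := by simp
    rw [spectralCoeff, integral_add_measure ((hint ν n).smul_measure htop)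
      ((hint _ n).smul_measure htop), integral_smul_measure, integral_smul_measure,
      integral_map hm.aemeasurable (fourier n).continuous.aestronglyMeasurable, spectralCoeff,
      spectralCoeff, mul_add]
    have hneg : ∀ x : UnitAddCircle, (fourier n (-x) : ℂ) = fourier (-n) x := fun x => by
      rw [fourier_apply, fourier_apply, smul_neg, neg_smul]
    simp_rw [hneg]
    simp [Complex.real_smul]
  refine ⟨ρ, ⟨?_⟩, fun n => ?_, fun n => ?_⟩
  · simp [ρ, ENNReal.inv_two_add_inv_two]
  · rw [hρ, hρ, neg_neg, add_comm]
  · have hconj : spectralCoeff ν (-n) = (starRingEnd ℂ) (spectralCoeff ν n) := by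
      rw [spectralCoeff, spectralCoeff, ← integral_conj]
      simp_rw [fourier_neg]
    rw [hρ, hconj, Complex.add_conj, show (2⁻¹ : ℂ) = ((2⁻¹ : ℝ) : ℂ) by norm_num,
      Complex.re_ofReal_mul, Complex.ofReal_re]
    ring

/-- The random series `∑ t, X t (ω t)` with independent uniform `ω t` has a law whose coefficient
at every time of stage `t` is within `O(2⁻ᵗ)` of the character average `-1/2` of stage `t`. -/
theorem exists_measure_of_stages (k : (t : ℕ) → (Fin t → ℤ) → ℤ)
    (X : (t : ℕ) → FormPair t → UnitAddCircle) (hX : ∀ t ω, ‖X t ω‖ ≤ (1 / 2) ^ t)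
    (hk : ∀ t (v : Fin t → ℤ), (∀ s, v s = 0 ∨ v s = 1 ∨ v s = -1) →
        (∀ τ < t, ∀ ω, k t v • X τ ω = 0) ∧
        (∀ ω : FormPair t, ‖k t v • X t ω
          - (((ω.quad v : ℝ) / 2 : ℝ) : UnitAddCircle)‖ ≤ (1 / 2) ^ t) ∧
        ∀ τ, t < τ → ∀ ω, ‖k t v • X τ ω‖ ≤ (1 / 2) ^ τ) :
    ∃ ν : Measure UnitAddCircle, IsProbabilityMeasure ν ∧
      ∀ t (v : Fin t → ℤ), (∀ s, v s = 0 ∨ v s = 1 ∨ v s = -1) → (∃ s, v s ≠ 0) →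
        (spectralCoeff ν (k t v)).re ≤ -1 / 2 + 4 * Real.pi * (1 / 2) ^ t := by
  let U : (t : ℕ) → Measure (FormPair t) := fun t => (PMF.uniformOfFintype (FormPair t)).toMeasure
  let P : Measure ((t : ℕ) → FormPair t) := Measure.infinitePi U
  let x : ((t : ℕ) → FormPair t) → UnitAddCircle := fun ω => ∑' t, X t (ω t)
  have hsumm : ∀ ω : (t : ℕ) → FormPair t, Summable fun t => X t (ω t) := fun ω =>
    Summable.of_norm_bounded summable_geometric_two fun t => hX t (ω t)
  have hXm : ∀ t, Measurable fun ω : (t : ℕ) → FormPair t => X t (ω t) := fun t =>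
    (measurable_of_finite (X t)).comp (measurable_pi_apply t)
  have hx : Measurable x := by
    refine measurable_of_tendsto_metrizable
      (f := fun (m : ℕ) (ω : (t : ℕ) → FormPair t) => ∑ t ∈ Finset.range m, X t (ω t))
      (fun m => Finset.measurable_fun_sum _ fun t _ => hXm t) ?_
    exact tendsto_pi_nhds.2 fun ω => (hsumm ω).hasSum.tendsto_sum_nat
  refine ⟨P.map x, Measure.isProbabilityMeasure_map hx.aemeasurable, fun t v hv hv0 => ?_⟩
  obtain ⟨h1, h2, h3⟩ := hk t v hv
  set c := k t v with hc
  let q : FormPair t → UnitAddCircle := fun ω => (((ω.quad v : ℝ) / 2 : ℝ) : UnitAddCircle)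
  have hclose : ∀ ω : (t : ℕ) → FormPair t, ‖c • x ω - q (ω t)‖ ≤ 2 * (1 / 2) ^ t := by
    intro ω
    have hs : HasSum (fun τ => c • X τ (ω τ)) (c • x ω) :=
      (hsumm ω).hasSum.map (zsmulAddGroupHom c : UnitAddCircle →+ UnitAddCircle)
        (continuous_zsmul c)
    have hs2 : HasSum (fun τ => c • X τ (ω τ) - if τ = t then q (ω t) else 0)
        (c • x ω - q (ω t)) := hs.sub (hasSum_ite_eq t (q (ω t)))
    have hs3 := (hasSum_nat_add_iff' (f := fun τ => c • X τ (ω τ)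
      - if τ = t then q (ω t) else 0) t).2 hs2
    -- the stages before `t` contribute nothing, stage `t` the phase `q`, and the rest a small tail
    have hz : ∑ i ∈ Finset.range t, (c • X i (ω i) - if i = t then q (ω t) else 0) = 0 :=
      Finset.sum_eq_zero fun i hi => by
        have hit := Finset.mem_range.1 hi
        rw [h1 i hit, if_neg hit.ne, sub_zero]
    rw [hz, sub_zero] at hs3
    have hg : HasSum (fun i : ℕ => ((1 : ℝ) / 2) ^ t * (1 / 2) ^ i) ((1 / 2) ^ t * 2) :=
      hasSum_geometric_two.mul_left _
    have hb : ∀ τ, t ≤ τ → ‖c • X τ (ω τ) - if τ = t then q (ω t) else 0‖ ≤ (1 / 2) ^ τ := by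
      intro τ hτ
      obtain rfl | hlt := hτ.eq_or_lt
      · rw [if_pos rfl]
        exact h2 (ω t)
      · rw [if_neg hlt.ne', sub_zero]
        exact h3 τ hlt _
    have := hs3.norm_le_of_bounded hg fun i => by
      rw [mul_comm, ← pow_add]
      exact hb _ (Nat.le_add_left t i)
    linarith
  -- by `hclose` the coefficient is nearly an average over the `t`-th factor alone
  have hcoeff : spectralCoeff (P.map x) c = ∫ ω, (AddCircle.toCircle (c • x ω) : ℂ) ∂P := by
    rw [spectralCoeff, integral_map hx.aemeasurable (fourier c).continuous.aestronglyMeasurable]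
    rfl
  have hm1 : Measurable fun ω : (t : ℕ) → FormPair t => (AddCircle.toCircle (c • x ω) : ℂ) :=
    (fourier c).continuous.measurable.comp hx
  have hm2 : Measurable fun ω : (t : ℕ) → FormPair t => (AddCircle.toCircle (q (ω t)) : ℂ) :=
    (measurable_of_finite fun ω => (AddCircle.toCircle (q ω) : ℂ)).comp (measurable_pi_apply t)
  have hi1 : Integrable (fun ω => (AddCircle.toCircle (c • x ω) : ℂ)) P :=
    Integrable.of_bound hm1.aestronglyMeasurable 1 (ae_of_all _ fun ω => (Circle.norm_coe _).le)
  have hi2 : Integrable (fun ω => (AddCircle.toCircle (q (ω t)) : ℂ)) P :=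
    Integrable.of_bound hm2.aestronglyMeasurable 1 (ae_of_all _ fun ω => (Circle.norm_coe _).le)
  have hq : (∫ ω, (AddCircle.toCircle (q (ω t)) : ℂ) ∂P).re = -1 / 2 := by
    have hre := integral_re hi2
    simp only [RCLike.re_to_complex] at hre
    have hmarg := integral_map (μ := P) (φ := fun ω => ω t)
      (f := fun ω : FormPair t => (AddCircle.toCircle (q ω) : ℂ).re)
      (measurable_pi_apply t).aemeasurable (measurable_of_finite _).aestronglyMeasurable
    rw [show P.map (fun ω => ω t) = U t from Measure.infinitePi_map_eval _ t] at hmarg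
    rw [← hre, ← hmarg, PMF.integral_eq_sum]
    obtain ⟨i, hi⟩ := hv0
    have hodd : (v i : ZMod 2) = 1 := by
      rcases hv i with h | h | h
      · exact absurd h hi
      · simp [h]
      · rw [h]
        decide
    simp only [q, FormPair.re_toCircle_div_two, PMF.uniformOfFintype_apply, smul_eq_mul]
    rw [← Finset.mul_sum, FormPair.sum_sign_quad v hodd]
    have hcard : (Fintype.card (FormPair t) : ℝ) ≠ 0 := by
      exact_mod_cast Fintype.card_ne_zero
    rw [ENNReal.toReal_inv, ENNReal.toReal_natCast]
    field_simp
  have hdiff : ‖∫ ω, (AddCircle.toCircle (c • x ω) : ℂ) ∂P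
      - ∫ ω, (AddCircle.toCircle (q (ω t)) : ℂ) ∂P‖ ≤ 4 * Real.pi * (1 / 2) ^ t := by
    rw [← integral_sub hi1 hi2]
    refine (norm_integral_le_of_norm_le_const (C := 4 * Real.pi * (1 / 2) ^ t)
      (ae_of_all _ fun ω => ?_)).trans (by simp)
    refine (UnitAddCircle.norm_toCircle_sub_le _ _).trans ?_
    nlinarith [hclose ω, Real.pi_pos]
  have hre := (Complex.abs_re_le_norm _).trans hdiff
  rw [Complex.sub_re, hq, ← hcoeff] at hre
  linarith [(abs_le.1 hre).2]

theorem Real.arccos_neg_half : Real.arccos (-1 / 2) = 2 * Real.pi / 3 := by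
  refine Real.arccos_eq_of_eq_cos (by positivity) (by linarith [Real.pi_pos]) ?_
  rw [show 2 * Real.pi / 3 = Real.pi - Real.pi / 3 by ring, Real.cos_pi_sub, Real.cos_pi_div_three]
  norm_num

theorem mainTheorem2 (p : Polynomial ℤ) (hp0 : p.eval 0 = 0) (hp : 1 < p.natDegree) :
    ∃ (ρ : Measure UnitAddCircle) (γ : Measure (ℤ → ℝ)) (A : Set (ℤ → ℝ))
      (n : (t : ℕ) → Fin t → ℕ),
      IsGaussianSystem ρ γ ∧
      A = {ω : ℤ → ℝ | 0 < ω 0} ∧ MeasurableSet A ∧ γ A = 1 / 2 ∧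
      (∀ (t : ℕ) (s : Fin t), 0 < n t s) ∧
      ∀ ε : ℝ, 0 < ε → ∃ t₀ : ℕ, ∀ t : ℕ, t₀ ≤ t →
        ∀ F : Finset (Fin t), F.Nonempty → ∀ ξ : Fin t → ℤ, (∀ s, ξ s = 1 ∨ ξ s = -1) →
          γ.real (A ∩ (shift ^ p.eval (∑ s ∈ F, ξ s * (n t s : ℤ))) ⁻¹' A) < 1 / 6 + ε := by
  obtain ⟨n, X, hn, hX, hk⟩ := exists_stage_sequence p hp0 hp
  obtain ⟨ν, hν, hνk⟩ := exists_measure_of_stages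
    (fun t v => p.eval (∑ s, v s * (n t s : ℤ))) X hX hk
  obtain ⟨ρ, hρ, hsymm, hre⟩ := exists_symmetrization ν
  obtain ⟨γ, hγ⟩ := exists_isGaussianSystem ρ hsymm
  refine ⟨ρ, γ, {ω | 0 < ω 0}, n, hγ, rfl,
    measurableSet_lt measurable_const (measurable_pi_apply 0), hγ.measure_pos, hn, fun ε hε => ?_⟩
  have hlim : Filter.Tendsto (fun t : ℕ =>
      (Real.pi - Real.arccos (-1 / 2 + 4 * Real.pi * (1 / 2) ^ t)) / (2 * Real.pi))
      Filter.atTop (nhds (1 / 6)) := by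
    have h0 : Filter.Tendsto (fun t : ℕ => -1 / 2 + 4 * Real.pi * (1 / 2 : ℝ) ^ t)
        Filter.atTop (nhds (-1 / 2 + 4 * Real.pi * 0)) :=
      ((tendsto_pow_atTop_nhds_zero_of_lt_one (by norm_num) (by norm_num)).const_mul _).const_add _
    have h1 := (((Real.continuous_arccos.tendsto _).comp h0).const_sub Real.pi).div_const
      (2 * Real.pi)
    rw [mul_zero, add_zero, Real.arccos_neg_half] at h1
    have hpi := Real.pi_ne_zero
    have h2 : (Real.pi - 2 * Real.pi / 3) / (2 * Real.pi) = 1 / 6 := by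
      field_simp
      norm_num
    rw [h2] at h1
    exact h1
  obtain ⟨t₀, ht₀⟩ := Filter.eventually_atTop.1
    (hlim.eventually (gt_mem_nhds (show (1 : ℝ) / 6 < 1 / 6 + ε by linarith)))
  refine ⟨t₀, fun t ht F hF ξ hξ => lt_of_le_of_lt ?_ (ht₀ t ht)⟩
  -- subsums are full sums with coefficients in `{0, ±1}`
  let v : Fin t → ℤ := fun s => if s ∈ F then ξ s else 0
  have hv : ∀ s, v s = 0 ∨ v s = 1 ∨ v s = -1 := fun s => by
    by_cases hs : s ∈ F
    · simpa [v, hs] using Or.inr (hξ s)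
    · simp [v, hs]
  have hv0 : ∃ s, v s ≠ 0 := by
    obtain ⟨s, hs⟩ := hF
    refine ⟨s, ?_⟩
    rcases hξ s with h | h <;> simp [v, hs, h]
  have hsum : ∑ s ∈ F, ξ s * (n t s : ℤ) = ∑ s, v s * (n t s : ℤ) := by
    simp only [v, ite_mul, zero_mul]
    rw [Finset.sum_ite_mem, Finset.univ_inter]
  rw [hsum]
  refine (hγ.measureReal_pos_inter_le _).trans ?_
  refine div_le_div_of_nonneg_right (sub_le_sub_left (Real.antitone_arccos ?_) _) (by positivity)
  rw [hre]
  exact hνk t v hv hv0
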